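/- Let $\mathcal H$ be an $n$-dimensional Cartan–Hadamard manifold, i.e. a complete, simply connected smooth Riemannian $n$-manifold all of whose sectional curvatures are nonpositive. Let $M$ be a closed (compact, without boundary, not necessarily connected) oriented smooth $m$-manifold and let $f: M\to\mathcal H$ be a smooth immersion. Let $dVol_M$ be the Riemannian volume measure on $M$ of the metric induced by $f$, and let $dVol_{M\times M}$ be the product measure $dVol_M\times dVol_M$. For $(x,y)\in M\times M$ let $r(x,y)$ be the distance between $f(x)$ and $f(y)$ in $\mathcal H$. Then $$\frac{1}{r^{m-1}}\in L^1(M\times M,\,dVol_{M\times M}),$$ that is, $\iint_{M\times M}\frac{1}{r^{m-1}}\,dVol_{M\times M}<\infty$. Where $r=0$ the integrand is read as $+\infty$ if $m\ge 2$; for $m=1$ it is identically $1$, and for $m=0$ it is $r$. -/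

import Mathlib

open MeasureTheory Manifold
open scoped ContDiff Bundle

noncomputable section

namespace ChordalIntegral

/-- The model space `ℝᵈ` with its Euclidean norm. -/
abbrev Model (d : ℕ) := EuclideanSpace ℝ (Fin d)

/-- The `i`-th standard basis vector of `ℝᵈ`. -/
abbrev stdVec {d : ℕ} (i : Fin d) : Model d := EuclideanSpace.single i 1

/-- The pullback `f^* g` of a Riemannian metric `g` on `N` under a map `f : M → N`, written in
the preferred chart `φ` of `M` at `x`: at the point `u` of the image of `φ` it is the matrix
`⟨d(f ∘ φ⁻¹)_u e_i, d(f ∘ φ⁻¹)_u e_j⟩`. -/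
def pullbackMetric {m n : ℕ} {M : Type*} [TopologicalSpace M] [ChartedSpace (Model m) M]
    {N : Type*} [TopologicalSpace N] [ChartedSpace (Model n) N]
    [Bundle.RiemannianBundle (fun y : N ↦ TangentSpace (𝓡 n) y)]
    (f : M → N) (x : M) (u : Model m) : Matrix (Fin m) (Fin m) ℝ :=
  Matrix.of fun i j ↦
    letI D : Model m → TangentSpace (𝓡 n) (f ((chartAt (Model m) x).symm u)) :=
      mfderiv (𝓡 m) (𝓡 n) (f ∘ (chartAt (Model m) x).symm) u
    inner ℝ (D (stdVec i)) (D (stdVec j))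

/-! ### Curvature of a Riemannian manifold, in charts -/

section Curvature

variable {n : ℕ} {N : Type*} [TopologicalSpace N] [ChartedSpace (Model n) N]
  [Bundle.RiemannianBundle (fun y : N ↦ TangentSpace (𝓡 n) y)]

/-- The matrix `g_ij` of the Riemannian metric of `N` in the preferred chart at `p`. -/
def metricMatrix (p : N) (u : Model n) : Matrix (Fin n) (Fin n) ℝ :=
  pullbackMetric (n := n) (id : N → N) p u

/-- The partial derivative `∂_i h` of a function on `ℝⁿ`. -/
def partialDeriv (i : Fin n) (h : Model n → ℝ) (u : Model n) : ℝ :=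
  fderiv ℝ h u (stdVec i)

/-- The Christoffel symbol `Γ^k_ij` of the Levi-Civita connection in the preferred chart at `p`. -/
def christoffel (p : N) (k i j : Fin n) (u : Model n) : ℝ :=
  (1 / 2) * ∑ l, (metricMatrix p u)⁻¹ k l *
    (partialDeriv i (fun v ↦ metricMatrix p v j l) u
      + partialDeriv j (fun v ↦ metricMatrix p v i l) u
      - partialDeriv l (fun v ↦ metricMatrix p v i j) u)

/-- The component `R^l_kij` of the Riemann curvature tensor in the preferred chart at `p`, with
`R(∂_i, ∂_j) ∂_k = ∑ l, R^l_kij ∂_l` and `R(X, Y) = [∇_X, ∇_Y] - ∇_[X, Y]`. -/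
def riemannTensor (p : N) (l k i j : Fin n) (u : Model n) : ℝ :=
  partialDeriv i (christoffel p l j k) u - partialDeriv j (christoffel p l i k) u
    + ∑ a, (christoffel p l i a u * christoffel p a j k u
      - christoffel p l j a u * christoffel p a i k u)

/-- The inner product at `p` of two tangent vectors, given by their coordinates in the
preferred chart at `p`. -/
def metricAt (p : N) (v w : Model n) : ℝ :=
  ∑ i, ∑ j, metricMatrix p (chartAt (Model n) p p) i j * v i * w j

/-- The sectional curvature
`⟨R(v, w) w, v⟩ / (⟨v, v⟩ ⟨w, w⟩ - ⟨v, w⟩²)` at `p` of the plane spanned by two linearly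
independent tangent vectors `v`, `w`, given by their coordinates in the preferred chart at `p`. -/
def sectionalCurvature (p : N) (v w : Model n) : ℝ :=
  (∑ i, ∑ j, ∑ k, ∑ l, ∑ q,
      metricMatrix p (chartAt (Model n) p p) l q *
        riemannTensor p l k i j (chartAt (Model n) p p) * v i * w j * w k * v q) /
    (metricAt p v v * metricAt p w w - metricAt p v w ^ 2)

end Curvature

/-- A Cartan-Hadamard manifold of dimension `n`: a complete, simply connected smooth Riemannian
`n`-manifold (with its Riemannian distance) whose sectional curvatures are all nonpositive. -/
structure IsCartanHadamard (n : ℕ) (N : Type*) [MetricSpace N] [ChartedSpace (Model n) N]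
    [IsManifold (𝓡 n) ∞ N] [Bundle.RiemannianBundle (fun y : N ↦ TangentSpace (𝓡 n) y)] :
    Prop where
  smooth_metric :
    IsContMDiffRiemannianBundle (𝓡 n) ∞ (Model n) (fun y : N ↦ TangentSpace (𝓡 n) y)
  dist_eq : IsRiemannianManifold (𝓡 n) N
  complete : CompleteSpace N
  simplyConnected : SimplyConnectedSpace N
  curvature_nonpos : ∀ (p : N) (v w : Model n), LinearIndependent ℝ ![v, w] →
    sectionalCurvature p v w ≤ 0

/-- An orientation of a smooth `m`-manifold, given by an oriented atlas: a family of smooth charts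
covering `M` all of whose transition maps have positive Jacobian determinant. -/
structure OrientedAtlas (m : ℕ) (M : Type*) [TopologicalSpace M] [ChartedSpace (Model m) M] where
  charts : Set (OpenPartialHomeomorph M (Model m))
  smooth : charts ⊆ IsManifold.maximalAtlas (𝓡 m) ∞ M
  covers : ∀ x : M, ∃ φ ∈ charts, x ∈ φ.source
  det_pos : ∀ φ ∈ charts, ∀ ψ ∈ charts, ∀ u ∈ (φ.symm.trans ψ).source,
    0 < (fderiv ℝ (ψ ∘ φ.symm) u).det

/-- The volume measure `√(det g_ij) du` of the pulled back metric `f^* g` on the domain of the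
preferred chart at `x`, as a measure on `M` which vanishes outside this domain. -/
def chartVolume (m n : ℕ) {M : Type*} [TopologicalSpace M] [ChartedSpace (Model m) M]
    [MeasurableSpace M] {N : Type*} [TopologicalSpace N] [ChartedSpace (Model n) N]
    [Bundle.RiemannianBundle (fun y : N ↦ TangentSpace (𝓡 n) y)] (f : M → N) (x : M) : Measure M :=
  ((volume.restrict (chartAt (Model m) x).target).withDensity
    fun u ↦ ENNReal.ofReal (√(pullbackMetric (n := n) f x u).det)).map (chartAt (Model m) x).symm

/-- The Riemannian volume measure `dVol_M` of the pulled back metric `f^* g` on `M`. The measures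
`chartVolume f x` agree on overlaps of charts, and their supremum is the measure on `M` that
restricts to `chartVolume f x` on the domain of the chart at `x`, for each `x` (`M` is assumed to
be second countable). -/
def inducedVolume (m n : ℕ) {M : Type*} [TopologicalSpace M] [ChartedSpace (Model m) M]
    [MeasurableSpace M] {N : Type*} [TopologicalSpace N] [ChartedSpace (Model n) N]
    [Bundle.RiemannianBundle (fun y : N ↦ TangentSpace (𝓡 n) y)] (f : M → N) : Measure M :=
  ⨆ x : M, chartVolume m n f x

end ChordalIntegral

end

/-! The singularity is integrable because its exponent `m - 1` is below the dimension `m`; the task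
is to make this uniform. Near each `p`, an immersion satisfies `|u - v| ≤ K d(f u, f v)` in chart
coordinates (`exists_edist_chartAt_le_of_isImmersionAt`), and its volume is at most a multiple of
Lebesgue measure (`chartVolume_le_volume`). For arbitrary `z` in the target, let `b` be a point of
the coordinate ball whose image is nearest to `z`. Then `|u - b| ≤ 2K d(f u, z)`, so the potential
of the ball at `z` is bounded by `∫ |u - b|^(1-m) du`, uniformly in `z`
(`exists_setLIntegral_inv_edist_pow_le`). Since `z` need not come from the same ball,
self-intersections of `f` need no separate treatment. By compactness finitely many balls bound the
total volume and the potential; Tonelli with `z = f y` concludes. -/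

namespace ChordalIntegral
-- Local comparison of Riemannian and coordinate distances
section Riemannian
open Set Filter Topology
open scoped NNReal ENNReal

variable {E : Type*} [NormedAddCommGroup E] [NormedSpace ℝ E]
  {H : Type*} [TopologicalSpace H] (I : ModelWithCorners ℝ E H)
  {N : Type*} [PseudoEMetricSpace N] [ChartedSpace H N]
  [Bundle.RiemannianBundle (fun y : N ↦ TangentSpace I y)]
  [IsManifold I 1 N] [IsContinuousRiemannianBundle E (fun y : N ↦ TangentSpace I y)]

/-- The differential of the preferred chart at `x` is locally bounded for the Riemannian norm. -/
lemma eventually_enorm_mfderiv_extChartAt_apply_le (x : N) :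
    ∃ C > (0 : ℝ≥0), ∀ᶠ y in 𝓝 x, ∀ v : TangentSpace I y,
      letI w : E := mfderiv I 𝓘(ℝ, E) (extChartAt I x) y v
      ‖w‖ₑ ≤ C * ‖v‖ₑ := by
  obtain ⟨C, hC0, hC⟩ := eventually_enorm_mfderiv_extChartAt_lt I x
  refine ⟨C, hC0, hC.mono fun y hy v ↦ ?_⟩
  let _ := normedAddCommGroupTangentSpaceVectorSpace (extChartAt I x y)
  let _ := normedSpaceTangentSpaceVectorSpace (extChartAt I x y)
  refine (ContinuousLinearMap.le_opENorm (mfderiv I 𝓘(ℝ, E) (extChartAt I x) y) v).trans ?_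
  gcongr
  exact hy.le

/-- The differential of the inverse of the preferred chart at `x` is locally bounded for the
Riemannian norm. -/
lemma eventually_norm_mfderivWithin_symm_extChartAt_apply_le (x : N) :
    ∃ C > (0 : ℝ), ∀ᶠ u in 𝓝[range I] (extChartAt I x x), ∀ v : E,
      ‖mfderivWithin 𝓘(ℝ, E) I (extChartAt I x).symm (range I) u v‖ ≤ C * ‖v‖ := by
  obtain ⟨C, hC0, hC⟩ := eventually_norm_mfderivWithin_symm_extChartAt_lt I x
  refine ⟨C, hC0, hC.mono fun u hu v ↦ ?_⟩
  let _ := normedAddCommGroupTangentSpaceVectorSpace u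
  let _ := normedSpaceTangentSpaceVectorSpace u
  refine (ContinuousLinearMap.le_opNorm
    (mfderivWithin 𝓘(ℝ, E) I (extChartAt I x).symm (range I) u) v).trans ?_
  exact mul_le_mul_of_nonneg_right hu.le (norm_nonneg _)

/-- The preferred charts of a Riemannian manifold are locally Lipschitz. -/
lemma exists_edist_extChartAt_le [IsRiemannianManifold I N] (x : N) :
    ∃ C : ℝ≥0, ∃ u ∈ 𝓝 x, ∀ y ∈ u, ∀ z ∈ u,
      edist (extChartAt I x y) (extChartAt I x z) ≤ C * edist y z := by
  obtain ⟨C, hC0, hC⟩ := eventually_enorm_mfderiv_extChartAt_apply_le I x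
  obtain ⟨ε, hε0, hε⟩ := EMetric.mem_nhds_iff.1
    (inter_mem hC (chart_source_mem_nhds H x))
  -- Two points within `δ` of `x` are joined by a path of length below `2δ`. It stays within `3δ <
  -- ε` of `x`, where the differential bound holds.
  have hδ0 : 0 < ε / 3 := ENNReal.div_pos hε0.ne' (by simp)
  obtain ⟨δ, hδ0, hδ⟩ := ENNReal.lt_iff_exists_nnreal_btwn.1 hδ0
  have hδ3 : (3 * δ : ℝ≥0∞) < ε := by
    rwa [mul_comm, ← ENNReal.lt_div_iff_mul_lt (by simp) (by simp)]
  refine ⟨C, Metric.eball x δ, Metric.eball_mem_nhds x hδ0, fun y hy z hz ↦ ?_⟩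
  rw [mul_comm]
  have hC0' : (C : ℝ≥0∞) ≠ 0 := by simpa using hC0.ne'
  rw [← ENNReal.div_le_iff_le_mul (.inl hC0') (.inl ENNReal.coe_ne_top)]
  refine le_of_forall_gt fun r hr ↦ ?_
  have hyz : edist y z < 2 * δ := by
    refine (edist_triangle_right y z x).trans_lt ?_
    rw [two_mul]
    exact ENNReal.add_lt_add hy hz
  -- The bound `r` gives the estimate, the bound `2δ` confines the path.
  have hmin : riemannianEDist I y z < min r (2 * δ) := by
    rw [← IsRiemannianManifold.out (I := I) y z]
    exact lt_min hr hyz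
  obtain ⟨γ, hγ0, hγ1, hγ, hlen, -⟩ :=
    exists_lt_locally_constant_of_riemannianEDist_lt hmin zero_lt_one
  have hmem : ∀ t ∈ Icc (0 : ℝ) 1, γ t ∈ Metric.eball x ε := by
    intro t ht
    have h1 : edist y (γ t) ≤ pathELength I γ 0 1 := by
      rw [IsRiemannianManifold.out (I := I) y (γ t)]
      exact (riemannianEDist_le_pathELength hγ.contMDiffOn hγ0 rfl ht.1).trans
        (pathELength_mono le_rfl ht.2)
    have h2 : edist y (γ t) < 2 * δ := h1.trans_lt (hlen.trans_le (min_le_right _ _))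
    rw [Metric.mem_eball]
    calc edist (γ t) x ≤ edist y (γ t) + edist y x := by
          rw [edist_comm y (γ t)]; exact edist_triangle _ _ _
      _ < 2 * δ + δ := ENNReal.add_lt_add h2 hy
      _ = 3 * δ := by ring
      _ < ε := hδ3
  set γ' : ℝ → E := extChartAt I x ∘ γ with hγ'
  have hsm : CMDiff[Icc 0 1] 1 γ' :=
    contMDiffOn_extChartAt.comp (I' := I) (t := (chartAt H x).source)
      hγ.contMDiffOn (fun t ht ↦ (hε (hmem t ht)).2)
  refine lt_of_le_of_lt ?_ (hlen.trans_le (min_le_left _ _))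
  rw [ENNReal.div_le_iff_le_mul (.inl hC0') (.inl ENNReal.coe_ne_top), mul_comm]
  calc edist (extChartAt I x y) (extChartAt I x z) = ‖γ' 1 - γ' 0‖ₑ := by
        rw [edist_comm, edist_eq_enorm_sub, hγ', Function.comp_apply, Function.comp_apply, hγ0, hγ1]
    _ ≤ ∫⁻ t in Icc 0 1, ‖derivWithin γ' (Icc 0 1) t‖ₑ :=
        enorm_sub_le_lintegral_derivWithin_Icc_of_contDiffOn_Icc
          (contMDiffOn_iff_contDiffOn.1 hsm) zero_le_one
    _ ≤ ∫⁻ t in Icc 0 1, C * ‖mfderivWithin 𝓘(ℝ, ℝ) I γ (Icc 0 1) t 1‖ₑ := by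
        refine setLIntegral_mono' measurableSet_Icc fun t ht ↦ ?_
        have h1 : mfderiv[Icc 0 1] γ' t =
            (mfderiv% (extChartAt I x) (γ t)) ∘L (mfderiv[Icc 0 1] γ t) := by
          apply mfderiv_comp_mfderivWithin
          · exact mdifferentiableAt_extChartAt (hε (hmem t ht)).2
          · exact (hγ.mdifferentiable one_ne_zero).mdifferentiableOn _ ht
          · rw [uniqueMDiffWithinAt_iff_uniqueDiffWithinAt]
            exact uniqueDiffOn_Icc zero_lt_one _ ht
        have h2 : derivWithin γ' (Icc 0 1) t =
            mfderiv I 𝓘(ℝ, E) (extChartAt I x) (γ t)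
              (mfderivWithin 𝓘(ℝ, ℝ) I γ (Icc 0 1) t 1) := by
          rw [← fderivWithin_derivWithin, ← mfderivWithin_eq_fderivWithin]
          exact congr($h1 1)
        rw [h2]
        exact (hε (hmem t ht)).1 _
    _ = C * pathELength I γ 0 1 := by
        rw [lintegral_const_mul' _ _ ENNReal.coe_ne_top,
          pathELength_eq_lintegral_mfderivWithin_Icc]
end Riemannian
-- Uniform bounds for the singular integral in Euclidean space
section Singular
open Set Filter Topology
open scoped NNReal ENNReal

lemma setLIntegral_ball_inv_enorm_pow_lt_top {k : ℕ} (R : ℝ) :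
    ∫⁻ w in Metric.ball (0 : Model (k + 1)) R, (‖w‖ₑ ^ k)⁻¹ < ⊤ := by
  have hint : IntegrableOn (fun w : Model (k + 1) ↦ (‖w‖ ^ k)⁻¹) (Metric.ball 0 R) := by
    refine integrableOn_ball_of_norm_le_rpow (C := 1) (α := k) (by simp) (by simp) ?_ ?_
    · refine ae_of_all _ fun w ↦ ?_
      rw [Real.rpow_neg (norm_nonneg _), Real.rpow_natCast, one_mul, norm_inv, norm_pow, norm_norm]
    · exact (by fun_prop : Measurable fun w : Model (k + 1) ↦ (‖w‖ ^ k)⁻¹).aestronglyMeasurable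
  refine lt_of_eq_of_lt (lintegral_congr_ae ?_) hint.2
  -- For `k > 0` the real and extended inverses differ at the origin (`0` against `⊤`), a null set
  -- in dimension `k + 1 ≥ 1`.
  have h0 : ∀ᵐ w : Model (k + 1) ∂volume.restrict (Metric.ball 0 R), w ≠ 0 :=
    ae_restrict_of_ae (Measure.ae_ne volume 0)
  filter_upwards [h0] with w hw
  rw [enorm_inv (pow_ne_zero _ (norm_ne_zero_iff.2 hw)), enorm_pow, enorm_norm]

/-- If `g` is continuous and bounded below by a multiple of the distance on a closed ball of
`ℝᵏ⁺¹`, then the integral of `dist (g u) z ^ (-k)` over this ball is bounded uniformly in `z`. -/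
lemma exists_setLIntegral_inv_edist_pow_le {k : ℕ} {N : Type*} [MetricSpace N]
    {g : Model (k + 1) → N} {K : ℝ≥0} {a : Model (k + 1)} {r : ℝ} (hr : 0 ≤ r) (hK0 : 0 < K)
    (hg : ContinuousOn g (Metric.closedBall a r))
    (hK : ∀ u ∈ Metric.closedBall a r, ∀ v ∈ Metric.closedBall a r,
      edist u v ≤ K * edist (g u) (g v)) :
    ∃ C : ℝ≥0∞, C < ⊤ ∧ ∀ z : N,
      ∫⁻ u in Metric.closedBall a r, (edist (g u) z ^ k)⁻¹ ≤ C := by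
  -- Differences of points of the closed ball have norm at most `2r`, hence lie in the open ball of
  -- radius `2r + 1`, whatever `b` is.
  refine ⟨(2 * K) ^ k *
    ∫⁻ w in Metric.ball (0 : Model (k + 1)) (2 * r + 1), (‖w‖ₑ ^ k)⁻¹,
    ENNReal.mul_lt_top (ENNReal.pow_lt_top (ENNReal.mul_lt_top (by simp) (by simp)))
      (setLIntegral_ball_inv_enorm_pow_lt_top _), fun z ↦ ?_⟩
  -- Replacing `z` by its nearest point `g b` costs a factor 2: `d(g u, g b) ≤ d(g u, z) + d(g b, z)
  -- ≤ 2 d(g u, z)`.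
  obtain ⟨b, hb, hmin⟩ := (isCompact_closedBall a r).exists_isMinOn ⟨a, by simpa using hr⟩
    (f := fun u ↦ edist (g u) z) (continuous_edist.comp_continuousOn (hg.prodMk continuousOn_const))
  have hbound : ∀ u ∈ Metric.closedBall a r,
      (edist (g u) z ^ k)⁻¹ ≤ (2 * K) ^ k * (‖u - b‖ₑ ^ k)⁻¹ := by
    intro u hu
    have h1 : ‖u - b‖ₑ ≤ 2 * K * edist (g u) z := by
      rw [← edist_eq_enorm_sub]
      calc edist u b ≤ K * edist (g u) (g b) := hK u hu b hb
        _ ≤ K * (edist (g u) z + edist (g b) z) := by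
          gcongr; exact edist_triangle_right _ _ _
        _ ≤ K * (edist (g u) z + edist (g u) z) := by
          gcongr; exact hmin hu
        _ = 2 * K * edist (g u) z := by ring
    have h0 : 2 * (K : ℝ≥0∞) ≠ 0 := mul_ne_zero two_ne_zero (by simpa using hK0.ne')
    have htop : (2 * (K : ℝ≥0∞)) ≠ ⊤ := ENNReal.mul_ne_top (by simp) (by simp)
    calc (edist (g u) z ^ k)⁻¹ = (2 * K) ^ k * ((2 * K * edist (g u) z) ^ k)⁻¹ := by
          rw [mul_pow _ (edist _ _), ENNReal.mul_inv (.inl (pow_ne_zero _ h0)) (.inl (ENNReal.pow_ne_top htop)),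
            ← mul_assoc, ENNReal.mul_inv_cancel (pow_ne_zero _ h0) (ENNReal.pow_ne_top htop),
            one_mul]
      _ ≤ _ := by gcongr
  calc ∫⁻ u in Metric.closedBall a r, (edist (g u) z ^ k)⁻¹
      ≤ ∫⁻ u in Metric.closedBall a r, (2 * K) ^ k * (‖u - b‖ₑ ^ k)⁻¹ :=
        setLIntegral_mono' Metric.isClosed_closedBall.measurableSet hbound
    _ = (2 * K) ^ k * ∫⁻ u in Metric.closedBall a r, (‖u - b‖ₑ ^ k)⁻¹ :=
        lintegral_const_mul' _ _ (ENNReal.pow_ne_top (ENNReal.mul_ne_top (by simp) (by simp)))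
    _ ≤ _ := by
        refine mul_le_mul' le_rfl ?_
        refine (lintegral_mono_set fun u hu ↦ ?_).trans_eq
          ((measurePreserving_sub_right volume b).setLIntegral_comp_preimage_emb
            (Homeomorph.subRight b).measurableEmbedding (fun w ↦ (‖w‖ₑ ^ k)⁻¹)
            (Metric.ball 0 (2 * r + 1)))
        rw [mem_preimage, mem_ball_zero_iff, ← dist_eq_norm]
        have := dist_triangle_right u b a
        rw [Metric.mem_closedBall] at hu hb
        linarith

end Singular

/-! ### Gram determinants -/

section Gram

/-- Gram matrices transform by congruence, `Aᵀ G A`, with `A` the matrix of `T` in the standard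
basis. -/
lemma det_gram_comp {m : ℕ} {V : Type*} [NormedAddCommGroup V] [InnerProductSpace ℝ V]
    (T : Model m →L[ℝ] Model m) (D D' : Fin m → V)
    (h : ∀ j, D' j = ∑ i, T (stdVec j) i • D i) :
    (Matrix.of fun i j ↦ inner ℝ (D' i) (D' j)).det =
      T.det ^ 2 * (Matrix.of fun i j ↦ inner ℝ (D i) (D j)).det := by
  set A : Matrix (Fin m) (Fin m) ℝ := LinearMap.toMatrix
    (EuclideanSpace.basisFun (Fin m) ℝ).toBasis (EuclideanSpace.basisFun (Fin m) ℝ).toBasis T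
    with hA
  have hAij : ∀ i j, A i j = T (stdVec j) i := fun i j ↦ by
    simp [hA, LinearMap.toMatrix_apply]
  have hdet : A.det = T.det := LinearMap.det_toMatrix _ _
  have hmul : (Matrix.of fun i j ↦ inner ℝ (D' i) (D' j)) =
      A.transpose * (Matrix.of fun i j ↦ inner ℝ (D i) (D j)) * A := by
    ext i j
    simp only [Matrix.of_apply, h, Matrix.mul_apply, Matrix.transpose_apply, hAij, sum_inner,
      inner_sum, inner_smul_left, inner_smul_right, Finset.sum_mul, Finset.mul_sum]
    refine Finset.sum_congr rfl fun k _ ↦ Finset.sum_congr rfl fun l _ ↦ ?_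
    simp
    ring
  rw [hmul, Matrix.det_mul, Matrix.det_mul, Matrix.det_transpose, hdet]
  ring

/-- Cauchy–Schwarz bounds each entry by `C ^ 2`; the Leibniz formula has `m!` terms, each a product
of `m` entries. -/
lemma abs_det_gram_le {m : ℕ} {V : Type*} [NormedAddCommGroup V] [InnerProductSpace ℝ V]
    {D : Fin m → V} {C : ℝ} (hD : ∀ i, ‖D i‖ ≤ C) :
    |(Matrix.of fun i j ↦ inner ℝ (D i) (D j)).det| ≤ m.factorial • (C ^ 2) ^ m := by
  have := Matrix.det_le (A := Matrix.of fun i j ↦ inner ℝ (D i) (D j))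
    (abv := (AbsoluteValue.abs : AbsoluteValue ℝ ℝ)) (x := C ^ 2) fun i j ↦ by
      refine (abs_real_inner_le_norm _ _).trans ?_
      rw [sq]
      exact mul_le_mul (hD i) (hD j) (norm_nonneg _) ((norm_nonneg _).trans (hD i))
  simpa using this

end Gram
-- Local estimates for immersions
section Immersion
open Set Filter Topology
open scoped NNReal

variable {m n : ℕ} {M : Type*} [TopologicalSpace M]
    [ChartedSpace (Model m) M] [IsManifold (𝓡 m) ∞ M]

/-- An immersion, composed with a chart of its target, has a local left inverse which is smooth in
charts. -/
lemma exists_contDiffAt_leftInverse {N : Type*} [TopologicalSpace N] [ChartedSpace (Model n) N]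
    [IsManifold (𝓡 n) ∞ N] {f : M → N} {p : M} (hf : IsImmersionAt (𝓡 m) (𝓡 n) ∞ f p) :
    ∃ h : Model n → Model m, ContDiffAt ℝ ∞ h (chartAt (Model n) (f p) (f p)) ∧
      ∀ᶠ x in 𝓝 p, h (chartAt (Model n) (f p) (f x)) = chartAt (Model m) p x := by
  set φ := hf.domChart
  set ψ := hf.codChart
  set χ := chartAt (Model m) p
  set c := chartAt (Model n) (f p)
  -- In adapted charts the immersion is `u ↦ (u, 0)` up to a linear equivalence, so projecting to
  -- the first factor undoes it.
  let P : Model n →L[ℝ] Model m :=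
    (ContinuousLinearMap.fst ℝ _ _).comp (hf.equiv.symm : Model n →L[ℝ] Model m × hf.complement)
  have hform : ∀ x ∈ φ.source, P (ψ (f x)) = φ x := by
    intro x hx
    have h1 := hf.writtenInCharts (show φ x ∈ (φ.extend (𝓡 m)).target by simpa using φ.map_source hx)
    have h2 : ψ (f x) = hf.equiv (φ x, 0) := by
      simpa [φ, ψ, φ.left_inv hx] using h1
    simp [P, h2]
  have hp : p ∈ φ.source := hf.mem_domChart_source
  have hfp : f p ∈ ψ.source := hf.mem_codChart_source
  have hc : f p ∈ c.source := mem_chart_source _ _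
  have hχ : p ∈ χ.source := mem_chart_source _ _
  refine ⟨fun w ↦ χ (φ.symm (P (ψ (c.symm w)))), ?_, ?_⟩
  · rw [← contMDiffAt_iff_contDiffAt]
    have h1 : ContMDiffAt (𝓡 n) (𝓡 n) ∞ c.symm (c (f p)) :=
      contMDiffAt_symm_of_mem_maximalAtlas (I := 𝓡 n) (IsManifold.chart_mem_maximalAtlas _)
        (c.map_source hc)
    have h2 : ContMDiffAt (𝓡 n) (𝓡 n) ∞ ψ (c.symm (c (f p))) := by
      rw [c.left_inv hc]
      exact contMDiffAt_of_mem_maximalAtlas hf.codChart_mem_maximalAtlas hfp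
    have h3 : ContMDiffAt (𝓡 n) (𝓡 m) ∞ P (ψ (c.symm (c (f p)))) := P.contDiff.contMDiff.contMDiffAt
    have hval : P (ψ (c.symm (c (f p)))) = φ p := by rw [c.left_inv hc, hform p hp]
    have h4 : ContMDiffAt (𝓡 m) (𝓡 m) ∞ φ.symm (P (ψ (c.symm (c (f p))))) := by
      rw [hval]
      exact contMDiffAt_symm_of_mem_maximalAtlas hf.domChart_mem_maximalAtlas (φ.map_source hp)
    have h5 : ContMDiffAt (𝓡 m) (𝓡 m) ∞ χ (φ.symm (P (ψ (c.symm (c (f p)))))) := by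
      rw [hval, φ.left_inv hp]
      exact contMDiffAt_of_mem_maximalAtlas (I := 𝓡 m) (IsManifold.chart_mem_maximalAtlas _) hχ
    have h21 : ContMDiffAt (𝓡 n) (𝓡 n) ∞ (fun w ↦ ψ (c.symm w)) (c (f p)) := h2.comp (c (f p)) h1
    have h321 : ContMDiffAt (𝓡 n) (𝓡 m) ∞ (fun w ↦ P (ψ (c.symm w))) (c (f p)) :=
      ContMDiffAt.comp (g := P) (f := fun w ↦ ψ (c.symm w)) (c (f p)) h3 h21
    have h4321 : ContMDiffAt (𝓡 n) (𝓡 m) ∞ (fun w ↦ φ.symm (P (ψ (c.symm w)))) (c (f p)) :=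
      ContMDiffAt.comp (g := φ.symm) (f := fun w ↦ P (ψ (c.symm w))) (c (f p)) h4 h321
    exact ContMDiffAt.comp (g := χ) (f := fun w ↦ φ.symm (P (ψ (c.symm w)))) (c (f p)) h5 h4321
  · filter_upwards [φ.open_source.mem_nhds hp,
      hf.continuousAt.preimage_mem_nhds (c.open_source.mem_nhds hc)] with x hx hfx
    rw [c.left_inv hfx, hform x hx, φ.left_inv hx]

variable {N : Type*} [MetricSpace N] [ChartedSpace (Model n) N] [IsManifold (𝓡 n) ∞ N]
  [Bundle.RiemannianBundle (fun y : N ↦ TangentSpace (𝓡 n) y)]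
  [IsContinuousRiemannianBundle (Model n) (fun y : N ↦ TangentSpace (𝓡 n) y)]

/-- The local left inverse is `C¹`, hence locally Lipschitz, and so is the chart of `N` for the
Riemannian distance; the constants multiply. -/
lemma exists_edist_chartAt_le_of_isImmersionAt [IsRiemannianManifold (𝓡 n) N] {f : M → N} {p : M}
    (hf : IsImmersionAt (𝓡 m) (𝓡 n) ∞ f p) :
    ∃ K : ℝ≥0, 0 < K ∧ ∃ s ∈ 𝓝 p, ∀ x ∈ s, ∀ y ∈ s,
      edist (chartAt (Model m) p x) (chartAt (Model m) p y) ≤ K * edist (f x) (f y) := by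
  obtain ⟨h, hh, hinv⟩ := exists_contDiffAt_leftInverse hf
  obtain ⟨K, t, ht, hK⟩ := (hh.of_le (by simp : (1 : ℕ∞ω) ≤ ∞)).exists_lipschitzOnWith
  have : IsManifold (𝓡 n) 1 N := .of_le (n := ∞) (by simp)
  obtain ⟨C, u, hu, hC⟩ := exists_edist_extChartAt_le (𝓡 n) (f p)
  have hcont : ContinuousAt (fun x ↦ chartAt (Model n) (f p) (f x)) p :=
    ((chartAt (Model n) (f p)).continuousAt (mem_chart_source _ _)).comp hf.continuousAt
  -- Adding 1 only ensures that the constant is positive.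
  refine ⟨K * C + 1, by positivity, _, inter_mem hinv
    (inter_mem (hf.continuousAt.preimage_mem_nhds hu) (hcont.preimage_mem_nhds ht)),
    fun x hx y hy ↦ ?_⟩
  rw [← (hx.1 : _ = _), ← (hy.1 : _ = _)]
  have h2 : edist (chartAt (Model n) (f p) (f x)) (chartAt (Model n) (f p) (f y)) ≤
      C * edist (f x) (f y) := by simpa using hC _ hx.2.1 _ hy.2.1
  calc _ ≤ K * edist (chartAt (Model n) (f p) (f x)) (chartAt (Model n) (f p) (f y)) :=
        hK hx.2.2 hy.2.2
    _ ≤ K * (C * edist (f x) (f y)) := by gcongr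
    _ = (K * C : ℝ≥0) * edist (f x) (f y) := by push_cast; ring
    _ ≤ _ := by gcongr; simp

/-- The differential of a smooth map, read in the preferred chart at `p` of its source, is locally
bounded. -/
lemma exists_norm_mfderiv_comp_chartAt_symm_le {f : M → N} (hf : ContMDiff (𝓡 m) (𝓡 n) ∞ f) (p : M) :
    ∃ C : ℝ, ∀ᶠ u in 𝓝 (chartAt (Model m) p p), ∀ i : Fin m,
      ‖mfderiv (𝓡 m) (𝓡 n) (f ∘ (chartAt (Model m) p).symm) u (stdVec i)‖ ≤ C := by
  have : IsManifold (𝓡 n) 1 N := .of_le (n := ∞) (by simp)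
  set χ := chartAt (Model m) p
  set e := extChartAt (𝓡 n) (f p)
  have hχ : p ∈ χ.source := mem_chart_source _ _
  have hs : ContMDiffAt (𝓡 m) (𝓡 n) ∞ (f ∘ χ.symm) (χ p) := hf.contMDiffAt.comp _
    (contMDiffAt_symm_of_mem_maximalAtlas (I := 𝓡 m) (IsManifold.chart_mem_maximalAtlas _)
      (χ.map_source hχ))
  have hval : (f ∘ χ.symm) (χ p) = f p := by simp [χ.left_inv hχ]
  -- Near `χ p`, `f ∘ χ⁻¹ = e⁻¹ ∘ F` with `F` a map of Euclidean spaces; the chain rule bounds the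
  -- differential by the product of two local bounds.
  set F : Model m → Model n := e ∘ f ∘ χ.symm with hF
  have hFs : ContDiffAt ℝ ∞ F (χ p) := by
    rw [← contMDiffAt_iff_contDiffAt]
    refine ContMDiffAt.comp _ ?_ hs
    rw [hval]
    exact contMDiffAt_extChartAt
  have hF1 : ContDiffAt ℝ 1 F (χ p) := hFs.of_le (by simp)
  have hFp : F (χ p) = e (f p) := by simp [F, χ.left_inv hχ]
  obtain ⟨C, hC0, hC⟩ := eventually_norm_mfderivWithin_symm_extChartAt_apply_le (𝓡 n) (f p)
  have hC' : ∀ᶠ u in 𝓝 (χ p), ∀ v : Model n,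
      ‖mfderiv (𝓡 n) (𝓡 n) e.symm (F u) v‖ ≤ C * ‖v‖ := by
    have : Tendsto F (𝓝 (χ p)) (𝓝 (e (f p))) := hFp ▸ hF1.continuousAt
    have h2 := hC
    simp only [modelWithCornersSelf_coe, range_id, nhdsWithin_univ, mfderivWithin_univ] at h2
    exact this.eventually h2
  have hbd : ∀ᶠ u in 𝓝 (χ p), ‖fderiv ℝ F u‖ < ‖fderiv ℝ F (χ p)‖ + 1 :=
    (hF1.continuousAt_fderiv one_ne_zero).norm.eventually_lt_const (lt_add_one _)
  have hd : ∀ᶠ u in 𝓝 (χ p), DifferentiableAt ℝ F u :=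
    (hF1.eventually (by simp)).mono fun u hu ↦ hu.differentiableAt one_ne_zero
  have hsrc : ∀ᶠ u in 𝓝 (χ p), (f ∘ χ.symm) u ∈ e.source :=
    hs.continuousAt.preimage_mem_nhds (hval ▸ extChartAt_source_mem_nhds (I := 𝓡 n) (f p))
  refine ⟨C * (‖fderiv ℝ F (χ p)‖ + 1), ?_⟩
  filter_upwards [hC', hbd, hd, hsrc.eventually_nhds] with u h1 h2 h3 h4 i
  have heq : f ∘ χ.symm =ᶠ[𝓝 u] e.symm ∘ F :=
    h4.mono fun v hv ↦ (e.left_inv hv).symm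
  have htar : F u ∈ e.target := e.map_source h4.self_of_nhds
  have he : MDifferentiableAt (𝓡 n) (𝓡 n) e.symm (F u) :=
    ((contMDiffOn_extChartAt_symm (I := 𝓡 n) (n := 1) (f p)).contMDiffAt
      ((isOpen_extChartAt_target (f p)).mem_nhds htar)).mdifferentiableAt one_ne_zero
  have hcomp : mfderiv (𝓡 m) (𝓡 n) (e.symm ∘ F) u =
      (mfderiv (𝓡 n) (𝓡 n) e.symm (F u)).comp (mfderiv (𝓡 m) (𝓡 n) F u) :=
    mfderiv_comp u he h3.mdifferentiableAt
  have key : ‖mfderiv (𝓡 m) (𝓡 n) (e.symm ∘ F) u (stdVec i)‖ ≤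
      C * (‖fderiv ℝ F (χ p)‖ + 1) := by
    rw [hcomp, mfderiv_eq_fderiv]
    refine (h1 (fderiv ℝ F u (stdVec i))).trans ?_
    gcongr
    refine ((fderiv ℝ F u).le_opNorm _).trans ?_
    simpa using h2.le
  -- The base points `e.symm (F u)` and `f (χ.symm u)` agree only propositionally, so the norm is
  -- transported between their tangent spaces.
  have hnorm : ∀ (q q' : N) (_ : q = q') (v : Model n),
      @norm (TangentSpace (𝓡 n) q) _ v = @norm (TangentSpace (𝓡 n) q') _ v := by
    rintro q _ rfl v
    rfl
  rw [heq.mfderiv_eq]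
  exact (hnorm _ _ heq.self_of_nhds _).trans_le key

end Immersion
-- Change of charts for the induced volume
section Volume
open Set Filter Topology
open scoped NNReal ENNReal

lemma _root_.ContinuousOn.measurableSet_inter_preimage {α β : Type*} [TopologicalSpace α]
    [MeasurableSpace α] [OpensMeasurableSpace α] [TopologicalSpace β] [MeasurableSpace β]
    [BorelSpace β] {g : α → β} {s : Set α} {t : Set β} (hg : ContinuousOn g s)
    (hs : MeasurableSet s) (ht : MeasurableSet t) : MeasurableSet (s ∩ g ⁻¹' t) := by
  have hc : Continuous fun x : s ↦ g x := continuousOn_iff_continuous_domRestrict.1 hg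
  have := hs.subtype_image (hc.measurable ht)
  convert this using 1
  ext x
  simp [and_comm]

variable {m n : ℕ} {M : Type*} [TopologicalSpace M] [ChartedSpace (Model m) M]
  {N : Type*} [TopologicalSpace N] [ChartedSpace (Model n) N]
  [Bundle.RiemannianBundle (fun y : N ↦ TangentSpace (𝓡 n) y)]

/-- The Gram matrices of the pulled back metric in two charts differ by the square of the Jacobian
determinant of the transition map. -/
lemma det_sq_mul_det_pullbackMetric [IsManifold (𝓡 m) ∞ M] {f : M → N} (hf : ContMDiff (𝓡 m) (𝓡 n) ∞ f) (p x : M)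
    {v : Model m} (hv : v ∈ (chartAt (Model m) p).target)
    (hvx : (chartAt (Model m) p).symm v ∈ (chartAt (Model m) x).source) :
    (fderiv ℝ (chartAt (Model m) x ∘ (chartAt (Model m) p).symm) v).det ^ 2 *
      (pullbackMetric (n := n) f x (chartAt (Model m) x ((chartAt (Model m) p).symm v))).det =
    (pullbackMetric (n := n) f p v).det := by
  set φ := chartAt (Model m) p
  set χ := chartAt (Model m) x
  set τ : Model m → Model m := χ ∘ φ.symm with hτ
  have h1 : ContMDiffAt (𝓡 m) (𝓡 m) ∞ φ.symm v :=
    contMDiffAt_symm_of_mem_maximalAtlas (IsManifold.chart_mem_maximalAtlas _) hv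
  have hτd : ContMDiffAt (𝓡 m) (𝓡 m) ∞ τ v :=
    (contMDiffAt_of_mem_maximalAtlas (IsManifold.chart_mem_maximalAtlas _) hvx).comp v h1
  have h2 : ContMDiffAt (𝓡 m) (𝓡 n) ∞ (f ∘ χ.symm) (τ v) :=
    hf.contMDiffAt.comp _ (contMDiffAt_symm_of_mem_maximalAtlas
      (IsManifold.chart_mem_maximalAtlas _) (χ.map_source hvx))
  have hcomp : mfderiv (𝓡 m) (𝓡 n) ((f ∘ χ.symm) ∘ τ) v =
      (mfderiv (𝓡 m) (𝓡 n) (f ∘ χ.symm) (τ v)).comp (mfderiv (𝓡 m) (𝓡 m) τ v) :=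
    mfderiv_comp v (h2.mdifferentiableAt (by simp)) (hτd.mdifferentiableAt (by simp))
  have heq : f ∘ φ.symm =ᶠ[𝓝 v] (f ∘ χ.symm) ∘ τ := by
    filter_upwards [h1.continuousAt.preimage_mem_nhds (χ.open_source.mem_nhds hvx)] with w hw
    simp only [Function.comp_apply, hτ]
    rw [χ.left_inv hw]
  have hpt : χ.symm (τ v) = φ.symm v := χ.left_inv hvx
  -- Both families are placed in one tangent space, although `χ.symm (τ v)` equals `φ.symm v` only
  -- propositionally.
  let V := TangentSpace (𝓡 n) (f (φ.symm v))
  let D : Fin m → V := fun i ↦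
    (mfderiv (𝓡 m) (𝓡 n) (f ∘ χ.symm) (τ v) (stdVec i) : Model n)
  let D' : Fin m → V := fun i ↦ (mfderiv (𝓡 m) (𝓡 n) (f ∘ φ.symm) v (stdVec i) : Model n)
  have hG : (pullbackMetric (n := n) f x (τ v)) = Matrix.of fun i j ↦ inner ℝ (D i) (D j) := by
    have hinner : ∀ (q q' : N) (_ : q = q') (a b : Model n),
        @inner ℝ (TangentSpace (𝓡 n) q) _ a b = @inner ℝ (TangentSpace (𝓡 n) q') _ a b := by
      rintro q _ rfl a b
      rfl
    ext i j
    exact hinner _ _ (congrArg f hpt) _ _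
  have hG' : (pullbackMetric (n := n) f p v) = Matrix.of fun i j ↦ inner ℝ (D' i) (D' j) := rfl
  change _ * (pullbackMetric (n := n) f x (τ v)).det = _
  rw [hG, hG', det_gram_comp (fderiv ℝ τ v) D D']
  intro j
  let L : Model m →ₗ[ℝ] Model n :=
    (mfderiv (𝓡 m) (𝓡 n) (f ∘ χ.symm) (τ v)).toLinearMap
  have h3 : D' j = L (fderiv ℝ τ v (stdVec j)) := by
    change mfderiv (𝓡 m) (𝓡 n) (f ∘ φ.symm) v (stdVec j) = _
    rw [heq.mfderiv_eq, hcomp, mfderiv_eq_fderiv]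
    rfl
  have h4 : fderiv ℝ τ v (stdVec j) = ∑ i, fderiv ℝ τ v (stdVec j) i • stdVec i := by
    conv_lhs => rw [← (EuclideanSpace.basisFun (Fin m) ℝ).sum_repr (fderiv ℝ τ v (stdVec j))]
    simp
  have h5 : L (fderiv ℝ τ v (stdVec j)) = ∑ i, fderiv ℝ τ v (stdVec j) i • L (stdVec i) := by
    conv_lhs => rw [h4, map_sum]
    simp only [map_smul]
  rw [h3]
  exact h5

variable [MeasurableSpace M] [BorelSpace M]

lemma chartVolume_apply (f : M → N) (x : M) {A : Set M} (hA : MeasurableSet A) :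
    chartVolume m n f x A =
      ∫⁻ u in (chartAt (Model m) x).target ∩ (chartAt (Model m) x).symm ⁻¹' A,
        ENNReal.ofReal (√(pullbackMetric (n := n) f x u).det) := by
  set χ := chartAt (Model m) x
  have hmeas : AEMeasurable χ.symm (volume.restrict χ.target) :=
    χ.continuousOn_symm.aemeasurable χ.open_target.measurableSet
  rw [chartVolume, Measure.map_apply_of_aemeasurable
    (hmeas.mono_ac (withDensity_absolutelyContinuous _ _)) hA, withDensity_apply',
    Measure.restrict_restrict' χ.open_target.measurableSet, inter_comm]

variable [IsManifold (𝓡 m) ∞ M]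

/-- Where the differential of an immersion is bounded in the chart at `p`, its volume in any other
chart is bounded by Lebesgue measure in the chart at `p`. -/
lemma chartVolume_le_volume {f : M → N} (hf : ContMDiff (𝓡 m) (𝓡 n) ∞ f) (p x : M) {C : ℝ}
    {A : Set M} (hA : MeasurableSet A) (hAp : A ⊆ (chartAt (Model m) p).source)
    (hC : ∀ y ∈ A, ∀ i : Fin m, ‖mfderiv (𝓡 m) (𝓡 n) (f ∘ (chartAt (Model m) p).symm)
      (chartAt (Model m) p y) (stdVec i)‖ ≤ C) :
    chartVolume m n f x A ≤ ENNReal.ofReal √(m.factorial • (C ^ 2) ^ m) *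
      volume ((chartAt (Model m) p).target ∩ (chartAt (Model m) p).symm ⁻¹' A) := by
  rw [chartVolume_apply f x hA]
  have hdet := fun v hv hvx ↦ det_sq_mul_det_pullbackMetric (n := n) hf p x (v := v) hv hvx
  have hτd : ∀ v, v ∈ (chartAt (Model m) p).target →
      (chartAt (Model m) p).symm v ∈ (chartAt (Model m) x).source →
      DifferentiableAt ℝ (chartAt (Model m) x ∘ (chartAt (Model m) p).symm) v := by
    intro v hv hvx
    rw [← mdifferentiableAt_iff_differentiableAt]
    exact ((contMDiffAt_of_mem_maximalAtlas (I := 𝓡 m) (n := ∞)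
      (IsManifold.chart_mem_maximalAtlas _) hvx).comp v (contMDiffAt_symm_of_mem_maximalAtlas
        (IsManifold.chart_mem_maximalAtlas _) hv)).mdifferentiableAt (by simp)
  set φ := chartAt (Model m) p
  set χ := chartAt (Model m) x
  set τ : Model m → Model m := χ ∘ φ.symm with hτ
  -- `S` is the part of `A` in both chart domains, read in the chart at `p`; the transition map `τ`
  -- carries it bijectively to the region of integration.
  set S : Set (Model m) := φ.target ∩ φ.symm ⁻¹' (A ∩ χ.source) with hS
  have hSm : MeasurableSet S := φ.continuousOn_symm.measurableSet_inter_preimage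
    φ.open_target.measurableSet (hA.inter χ.open_source.measurableSet)
  have himage : τ '' S = χ.target ∩ χ.symm ⁻¹' A := by
    ext u
    constructor
    · rintro ⟨v, ⟨hv, hvA, hvx⟩, rfl⟩
      refine ⟨χ.map_source hvx, ?_⟩
      rwa [mem_preimage, hτ, Function.comp_apply, χ.left_inv hvx]
    · rintro ⟨hu, huA⟩
      refine ⟨φ (χ.symm u), ⟨φ.map_source (hAp huA), ?_⟩, ?_⟩
      · rw [mem_preimage, φ.left_inv (hAp huA)]
        exact ⟨huA, χ.map_target hu⟩
      · rw [hτ, Function.comp_apply, φ.left_inv (hAp huA), χ.right_inv hu]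
  have hinj : InjOn τ S := by
    rintro v ⟨hv, -, hvx⟩ w ⟨hw, -, hwx⟩ h
    exact φ.symm.injOn hv hw (χ.injOn hvx hwx h)
  rw [← himage, lintegral_image_eq_lintegral_abs_det_fderiv_mul volume hSm
    (fun v hv ↦ (hτd v hv.1 hv.2.2).hasFDerivAt.hasFDerivWithinAt) hinj]
  calc _ ≤ ∫⁻ v in S, ENNReal.ofReal √(m.factorial • (C ^ 2) ^ m) := by
        refine setLIntegral_mono' hSm fun v hv ↦ ?_
        rw [← ENNReal.ofReal_mul (abs_nonneg _)]
        refine ENNReal.ofReal_le_ofReal ?_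
        -- Writing the Jacobian as `√(det²)` merges it with the density, leaving the Gram
        -- determinant in the chart at `p`.
        rw [← Real.sqrt_sq_eq_abs, ← Real.sqrt_mul (sq_nonneg _)]
        refine Real.sqrt_le_sqrt ?_
        refine (hdet v hv.1 hv.2.2).trans_le ((le_abs_self _).trans ?_)
        refine abs_det_gram_le (V := TangentSpace (𝓡 n) (f (φ.symm v))) fun i ↦ ?_
        have := hC _ hv.2.1 i
        rwa [φ.right_inv hv.1] at this
    _ ≤ _ := by
        rw [setLIntegral_const]
        gcongr
        exact fun v hv ↦ ⟨hv.1, hv.2.1⟩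

end Volume
-- Uniform potential bounds and the double integral
section Potential
open Set Filter Topology
open scoped NNReal

variable {m n : ℕ} {M : Type*} [TopologicalSpace M] [ChartedSpace (Model m) M]
  [IsManifold (𝓡 m) ∞ M] [MeasurableSpace M] [BorelSpace M]
  {N : Type*} [MetricSpace N] [ChartedSpace (Model n) N] [IsManifold (𝓡 n) ∞ N]
  [Bundle.RiemannianBundle (fun y : N ↦ TangentSpace (𝓡 n) y)]
  [IsContinuousRiemannianBundle (Model n) (fun y : N ↦ TangentSpace (𝓡 n) y)]
  [IsRiemannianManifold (𝓡 n) N]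

/-- A single `ν`, a multiple of Lebesgue measure on a coordinate ball pushed to `M`, dominates the
volumes of all charts at once. This is what controls their supremum `inducedVolume`. -/
lemma exists_local_dominating_measure {f : M → N} (hf : IsImmersion (𝓡 m) (𝓡 n) ∞ f) (p : M) :
    ∃ U ∈ 𝓝 p, MeasurableSet U ∧ ∃ ν : Measure M, ν univ < ⊤ ∧
      (∀ x A, MeasurableSet A → A ⊆ U → chartVolume m n f x A ≤ ν A) ∧
      ∃ B < ⊤, ∀ z : N, ∫⁻ x, (edist (f x) z ^ (m - 1))⁻¹ ∂ν ≤ B := by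
  have hsm : ContMDiff (𝓡 m) (𝓡 n) ∞ f := fun x ↦ (hf.isImmersionAt x).contMDiffAt
  obtain ⟨K, hK0, s, hs, hK⟩ := exists_edist_chartAt_le_of_isImmersionAt (hf.isImmersionAt p)
  obtain ⟨C, hC⟩ := exists_norm_mfderiv_comp_chartAt_symm_le hsm p
  have hvol := fun x A ↦ chartVolume_le_volume (n := n) hsm p x (C := C) (A := A)
  set φ := chartAt (Model m) p
  have hp : p ∈ φ.source := mem_chart_source _ _
  have hs' : ∀ᶠ u in 𝓝 (φ p), φ.symm u ∈ s :=
    (φ.continuousAt_symm (φ.map_source hp)).preimage_mem_nhds (by rwa [φ.left_inv hp])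
  obtain ⟨r, hr0, hr⟩ := Metric.nhds_basis_closedBall.mem_iff.1
    (inter_mem (φ.open_target.mem_nhds (φ.map_source hp)) (inter_mem hs' hC))
  set a := φ p
  have hBm : MeasurableSet (Metric.closedBall a r) := Metric.isClosed_closedBall.measurableSet
  have hcont : ContinuousOn φ.symm (Metric.closedBall a r) :=
    φ.continuousOn_symm.mono fun u hu ↦ (hr hu).1
  have hae : AEMeasurable φ.symm (volume.restrict (Metric.closedBall a r)) :=
    hcont.aemeasurable hBm
  have hopen : IsOpen (φ.source ∩ φ ⁻¹' Metric.ball a r) :=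
    φ.isOpen_inter_preimage Metric.isOpen_ball
  have hfin : volume (Metric.closedBall a r) < ⊤ := measure_closedBall_lt_top
  set c : ENNReal := ENNReal.ofReal √(m.factorial • (C ^ 2) ^ m) with hc
  refine ⟨φ.source ∩ φ ⁻¹' Metric.ball a r,
    hopen.mem_nhds ⟨hp, Metric.mem_ball_self hr0⟩, hopen.measurableSet,
    c • (volume.restrict (Metric.closedBall a r)).map φ.symm, ?_, fun x A hA hAU ↦ ?_, ?_⟩
  · rw [Measure.smul_apply, Measure.map_apply_of_aemeasurable hae .univ]
    simpa using ENNReal.mul_lt_top ENNReal.ofReal_lt_top hfin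
  · refine (hvol x A hA (fun y hy ↦ (hAU hy).1) fun y hy i ↦ ?_).trans ?_
    · exact (hr (Metric.ball_subset_closedBall (hAU hy).2)).2.2 i
    · rw [Measure.smul_apply, Measure.map_apply_of_aemeasurable hae hA, smul_eq_mul,
        Measure.restrict_apply' hBm]
      refine mul_le_mul' le_rfl (measure_mono ?_)
      rintro u ⟨hu, huA⟩
      refine ⟨huA, ?_⟩
      have := (hAU huA).2
      rw [mem_preimage, φ.right_inv hu] at this
      exact Metric.ball_subset_closedBall this
  · have hbound : ∃ B < ⊤, ∀ z : N,
        ∫⁻ u in Metric.closedBall a r, (edist (f (φ.symm u)) z ^ (m - 1))⁻¹ ≤ B := by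
      have hg : ContinuousOn (fun u ↦ f (φ.symm u)) (Metric.closedBall a r) :=
        hsm.continuous.comp_continuousOn hcont
      have hKB : ∀ u ∈ Metric.closedBall a r, ∀ v ∈ Metric.closedBall a r,
          edist u v ≤ K * edist (f (φ.symm u)) (f (φ.symm v)) := fun u hu v hv ↦ by
        have := hK _ (hr hu).2.1 _ (hr hv).2.1
        rwa [φ.right_inv (hr hu).1, φ.right_inv (hr hv).1] at this
      clear_value c φ a
      clear hvol hC
      -- For `m = 0` the truncated exponent `m - 1` is `0`, and the integrand is constantly 1.
      rcases m with _ | k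
      · exact ⟨volume (Metric.closedBall a r), hfin, fun z ↦ by simp⟩
      · exact exists_setLIntegral_inv_edist_pow_le hr0.le hK0 hg hKB
    obtain ⟨B, hB, hBz⟩ := hbound
    refine ⟨c * B, ENNReal.mul_lt_top ENNReal.ofReal_lt_top hB, fun z ↦ ?_⟩
    have hmeas : Measurable fun x ↦ (edist (f x) z ^ (m - 1))⁻¹ :=
      ((hsm.continuous.edist continuous_const).measurable.pow_const _).inv
    rw [lintegral_smul_measure, lintegral_map' hmeas.aemeasurable hae, smul_eq_mul]
    gcongr
    exact hBz z

variable {f : M → N}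

/-- The induced volume of a compact immersed manifold is finite, and the potentials
`∫ dist (f x) z ^ (1 - m)` are bounded uniformly in `z`. -/
lemma inducedVolume_lt_top_and_exists_potential_le [CompactSpace M]
    (hf : IsImmersion (𝓡 m) (𝓡 n) ∞ f) :
    inducedVolume m n f univ < ⊤ ∧
      ∃ B < ⊤, ∀ z : N, ∫⁻ x, (edist (f x) z ^ (m - 1))⁻¹ ∂inducedVolume m n f ≤ B := by
  choose U hU hUm ν hν hle B hB hBz using exists_local_dominating_measure hf
  obtain ⟨t, ht⟩ := CompactSpace.elim_nhds_subcover U hU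
  -- A supremum of measures lies below any common upper bound. Overlaps of the cover are harmless,
  -- since only subadditivity is used.
  have hdom : inducedVolume m n f ≤ ∑ p ∈ t, ν p := by
    refine iSup_le fun x ↦ Measure.le_iff.2 fun A hA ↦ ?_
    have hcover : A ⊆ ⋃ p ∈ t, A ∩ U p := fun y hy ↦ by
      have : y ∈ ⋃ p ∈ t, U p := ht ▸ mem_univ y
      simp only [mem_iUnion, exists_prop] at this ⊢
      obtain ⟨p, hp, hyp⟩ := this
      exact ⟨p, hp, hy, hyp⟩
    calc chartVolume m n f x A ≤ chartVolume m n f x (⋃ p ∈ t, A ∩ U p) := measure_mono hcover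
      _ ≤ ∑ p ∈ t, chartVolume m n f x (A ∩ U p) := measure_biUnion_finset_le _ _
      _ ≤ ∑ p ∈ t, ν p A := Finset.sum_le_sum fun p _ ↦
          (hle p x _ (hA.inter (hUm p)) inter_subset_right).trans (measure_mono inter_subset_left)
      _ = (∑ p ∈ t, ν p) A := by rw [Measure.finsetSum_apply]
  refine ⟨(hdom univ).trans_lt ?_, ∑ p ∈ t, B p, ENNReal.sum_lt_top.2 fun p _ ↦ hB p, fun z ↦ ?_⟩
  · rw [Measure.finsetSum_apply]
    exact ENNReal.sum_lt_top.2 fun p _ ↦ hν p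
  · refine (lintegral_mono' hdom le_rfl).trans ?_
    rw [lintegral_finsetSum_measure]
    exact Finset.sum_le_sum fun p _ ↦ hBz p z

lemma lintegral_prod_inv_edist_zpow_lt_top [CompactSpace M] [SFinite (inducedVolume m n f)]
    (hf : IsImmersion (𝓡 m) (𝓡 n) ∞ f) :
    ∫⁻ p : M × M, 1 / edist (f p.1) (f p.2) ^ ((m : ℤ) - 1)
      ∂((inducedVolume m n f).prod (inducedVolume m n f)) < ⊤ := by
  obtain ⟨hvol, B, hB, hBz⟩ := inducedVolume_lt_top_and_exists_potential_le hf
  have hcont : Continuous f :=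
    continuous_iff_continuousAt.2 fun x ↦ (hf.isImmersionAt x).continuousAt
  have : SecondCountableTopology M := ChartedSpace.secondCountable_of_sigmaCompact (Model m) M
  have hmeas : Measurable fun p : M × M ↦ edist (f p.1) (f p.2) :=
    ((hcont.comp continuous_fst).edist (hcont.comp continuous_snd)).measurable
  set μ := inducedVolume m n f
  -- For `m = 0` the integrand is the distance itself, bounded by the diameter of the compact image.
  rcases m.eq_zero_or_pos with hm | hm
  · have hdiam : Metric.ediam (range f) ≠ ⊤ := (isCompact_range hcont).isBounded.ediam_ne_top
    calc _ ≤ ∫⁻ _ : M × M, Metric.ediam (range f) ∂(μ.prod μ) := by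
          refine lintegral_mono fun p ↦ ?_
          rw [hm, Nat.cast_zero, zero_sub, zpow_neg_one, one_div, inv_inv]
          exact Metric.edist_le_ediam_of_mem (mem_range_self p.1) (mem_range_self p.2)
      _ = Metric.ediam (range f) * (μ univ * μ univ) := by
          rw [lintegral_const, ← univ_prod_univ, Measure.prod_prod]
      _ < ⊤ := ENNReal.mul_lt_top hdiam.lt_top (ENNReal.mul_lt_top hvol hvol)
  · have hexp : (m : ℤ) - 1 = (m - 1 : ℕ) := by omega
    simp only [hexp, zpow_natCast, one_div]
    have hmeas' : Measurable fun p : M × M ↦ (edist (f p.1) (f p.2) ^ (m - 1))⁻¹ :=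
      (hmeas.pow_const _).inv
    -- With the second variable `y` fixed, the inner integral is the potential at `z = f y`.
    rw [lintegral_prod_symm _ hmeas'.aemeasurable]
    calc _ ≤ ∫⁻ _ : M, B ∂μ := lintegral_mono fun y ↦ hBz (f y)
      _ = B * μ univ := lintegral_const _
      _ < ⊤ := ENNReal.mul_lt_top hB hvol

end Potential

/-! ### From extended to real-valued integrands -/

section Integrability
open scoped NNReal

/-- Only an inequality: at distance `0` with `j > 0` the real quotient is `0` by convention, while
the extended one is `⊤`. -/
lemma enorm_one_div_dist_zpow_le {N : Type*} [PseudoMetricSpace N] (x y : N) (j : ℤ) :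
    ‖1 / dist x y ^ j‖ₑ ≤ 1 / edist x y ^ j := by
  rw [dist_nndist, edist_nndist, one_div, one_div]
  have hreal : ((nndist x y : ℝ) ^ j)⁻¹ = ((nndist x y ^ j)⁻¹ : ℝ≥0) := by push_cast; rfl
  rw [hreal, Real.enorm_eq_ofReal (by positivity), ENNReal.ofReal_coe_nnreal]
  rcases eq_or_ne (nndist x y) 0 with h | h
  · rcases lt_trichotomy j 0 with hj | rfl | hj
    · simp [h, zero_zpow j hj.ne]
    · simp
    · simp [h, zero_zpow j hj.ne']
  · rw [← ENNReal.coe_zpow h, ENNReal.coe_inv (zpow_ne_zero _ h)]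

end Integrability
end ChordalIntegral

theorem mainTheorem8 {m n : ℕ}
    {M : Type*} [TopologicalSpace M] [CompactSpace M] [T2Space M]
    [ChartedSpace (ChordalIntegral.Model m) M] [IsManifold (𝓡 m) ∞ M]
    [MeasurableSpace M] [BorelSpace M]
    (_orientation : ChordalIntegral.OrientedAtlas m M)
    {N : Type*} [MetricSpace N]
    [ChartedSpace (ChordalIntegral.Model n) N] [IsManifold (𝓡 n) ∞ N]
    [Bundle.RiemannianBundle (fun y : N ↦ TangentSpace (𝓡 n) y)]
    (hN : ChordalIntegral.IsCartanHadamard n N)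
    (f : M → N) (hf : IsImmersion (𝓡 m) (𝓡 n) ∞ f) :
    Integrable (fun p : M × M ↦ 1 / dist (f p.1) (f p.2) ^ ((m : ℤ) - 1))
        ((ChordalIntegral.inducedVolume m n f).prod (ChordalIntegral.inducedVolume m n f)) ∧
      ∫⁻ p : M × M, 1 / edist (f p.1) (f p.2) ^ ((m : ℤ) - 1)
        ∂((ChordalIntegral.inducedVolume m n f).prod (ChordalIntegral.inducedVolume m n f)) < ⊤ := by
  have hsmooth := hN.smooth_metric
  have := hN.dist_eq
  have : IsContinuousRiemannianBundle (ChordalIntegral.Model n)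
      (fun y : N ↦ TangentSpace (𝓡 n) y) := by
    obtain ⟨g, hg, hg'⟩ := hsmooth.exists_contMDiff
    exact ⟨g, hg.continuous, hg'⟩
  have : IsFiniteMeasure (ChordalIntegral.inducedVolume m n f) :=
    ⟨(ChordalIntegral.inducedVolume_lt_top_and_exists_potential_le hf).1⟩
  have hlt := ChordalIntegral.lintegral_prod_inv_edist_zpow_lt_top hf
  have hcont : Continuous f :=
    continuous_iff_continuousAt.2 fun x ↦ (hf.isImmersionAt x).continuousAt
  have : SecondCountableTopology M :=
    ChartedSpace.secondCountable_of_sigmaCompact (ChordalIntegral.Model m) M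
  have hmeas : Measurable fun p : M × M ↦ dist (f p.1) (f p.2) :=
    ((hcont.comp continuous_fst).dist (hcont.comp continuous_snd)).measurable
  have hmeas' : Measurable fun p : M × M ↦ 1 / dist (f p.1) (f p.2) ^ ((m : ℤ) - 1) := by
    fun_prop
  exact ⟨⟨hmeas'.aestronglyMeasurable, (lintegral_mono fun p ↦
    ChordalIntegral.enorm_one_div_dist_zpow_le _ _ _).trans_lt hlt⟩, hlt⟩
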